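/- Notation. Let $X$ be a random vector in $\mathbb{R}^n$, $n\ge 2$, and let $\theta,\mathcal{L}>0$ with $\mathcal{L}\theta<1$. We say that $X$ satisfies the weak small-ball assumption with constants $\theta$ and $\mathcal{L}$ if for every $1\le k\le n-1$, every $k$-dimensional subspace $F\subset\mathbb{R}^n$ and every $z\in\mathbb{R}^n$, $$\mathbb{P}\left(\|P_FX-z\|_2\le\theta\sqrt{k}\right)\le(\mathcal{L}\theta)^k,$$ where $P_F$ is the orthogonal projection onto $F$. For a linear map $T:\mathbb{R}^n\to\mathbb{R}^m$ with nonzero singular values $s_1\ge\dots\ge s_r>0$, let $\|T\|_{S_p}=\left(\sum_{i=1}^r s_i^p\right)^{1/p}$ for $0<p<\infty$ and $\|T\|_{S_\infty}=s_1$. For $T\neq0$ and $2<q\le\infty$ the $q$-stable rank of $T$ is $$\mathrm{srank}_q(T)=\left(\frac{\|T\|_{S_2}}{\|T\|_{S_q}}\right)^{\frac{2q}{q-2}},$$ where $q/(q-2)=1$ for $q=\infty$. Theorem (coordinate small-ball estimate). There exist an absolute constant $c>0$ and constants $c_q$, $2<q\le\infty$, depending only on $q$ and satisfying $0<c_q\le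 c\left(\frac{q}{q-2}\right)^{1/2}$, such that the following holds. Let $n\ge2$ and $m\ge1$, let $X$ be a random vector in $\mathbb{R}^n$ that satisfies the weak small-ball assumption with constants $\theta$ and $\mathcal{L}$, let $(u_i)_{i=1}^m$ be an orthonormal basis of $\mathbb{R}^m$, and let $T:\mathbb{R}^n\to\mathbb{R}^m$ be a linear map such that $\|T^*u_i\|_2=1$ for every $1\le i\le m$. Let $2<q\le\infty$ and set $k_q=\mathrm{srank}_q(T)$. Then for every $s\in(0,1)$, $$\mathbb{P}\left(\left|\left\{i\le m:|\langle TX,u_i\rangle|\ge\theta\right\}\right|\le(1-s)m\right)\le 2\left(\frac{2}{s}\right)^{\frac{q}{q-2}}\frac{m}{k_q}\left(\frac{c_q\mathcal{L}\theta}{s}\right)^{\frac12\left(\frac{s}{2}\right)^{\frac{q}{q-2}}k_q}.$$ -/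

import Mathlib

open MeasureTheory
open scoped ENNReal

/-- The weak small-ball assumption with constants `θ` and `L` for a random vector `X` in `ℝⁿ`
defined on the measure space `(Ω, μ)`: `L θ < 1`, and for every `1 ≤ k ≤ n - 1`, every
`k`-dimensional subspace `F` and every `z`,
`ℙ (‖P_F X - z‖₂ ≤ θ √k) ≤ (L θ) ^ k`, where `P_F` is the orthogonal projection onto `F`. -/
structure WeakSmallBall {Ω : Type*} [MeasurableSpace Ω] (μ : Measure Ω) {n : ℕ}
    (X : Ω → EuclideanSpace ℝ (Fin n)) (θ L : ℝ) : Prop where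
  theta_pos : 0 < θ
  const_pos : 0 < L
  mul_lt_one : L * θ < 1
  small_ball : ∀ k : ℕ, 1 ≤ k → k + 1 ≤ n →
    ∀ F : Submodule ℝ (EuclideanSpace ℝ (Fin n)), Module.finrank ℝ F = k →
      ∀ z : EuclideanSpace ℝ (Fin n),
        μ.real {ω | ‖F.starProjection (X ω) - z‖ ≤ θ * √(k : ℝ)} ≤ (L * θ) ^ k

/-- The Schatten norm `‖T‖_{S_q}`, `0 < q ≤ ∞`: the `ℓ_q` norm of the sequence of nonzero singular
values of `T` (listed by Mathlib in decreasing order, from index `0` to `rank T - 1`). For `q = ∞`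
it is the largest singular value. -/
noncomputable def schattenNorm {n m : ℕ}
    (T : EuclideanSpace ℝ (Fin n) →ₗ[ℝ] EuclideanSpace ℝ (Fin m)) (q : ℝ≥0∞) : ℝ :=
  if q = ∞ then T.singularValues 0
  else (∑ i ∈ Finset.range (Module.finrank ℝ T.range),
    T.singularValues i ^ q.toReal) ^ (1 / q.toReal)

/-- The exponent `q / (q - 2)` for `2 < q ≤ ∞`, equal to `1` for `q = ∞`. -/
noncomputable def stableExponent (q : ℝ≥0∞) : ℝ :=
  if q = ∞ then 1 else q.toReal / (q.toReal - 2)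

/-- The `q`-stable rank `(‖T‖_{S_2} / ‖T‖_{S_q}) ^ (2 q / (q - 2))`, for `2 < q ≤ ∞`. -/
noncomputable def stableRank {n m : ℕ}
    (T : EuclideanSpace ℝ (Fin n) →ₗ[ℝ] EuclideanSpace ℝ (Fin m)) (q : ℝ≥0∞) : ℝ :=
  (schattenNorm T 2 / schattenNorm T q) ^ (2 * stableExponent q)

/-!
Let `v i = T* u_i`, a unit vector, so that `⟨T X, u_i⟩ = ⟨X, v i⟩`. Let `p = q / (q - 2)`, let
`k` be the stable rank and `D = (1 / 2) (s / 2) ^ p k` the exponent of the claim, and `d = ⌈D⌉`. In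
the event in question the set `A` of the coordinates with `|⟨X, v i⟩| ≤ θ` has at least `s m`
elements. The volume of the parallelepiped spanned by a tuple of vectors `v i` serves as a weight,
and the expected total weight of the `d`-tuples of elements of `A` is bounded from both sides.

* For a fixed tuple, the weight times the probability that the tuple lies in `A` is at most
  `(C L θ) ^ d`. The set `{|⟨x, v i⟩| ≤ θ}` is a parallelepiped in the span of the tuple, whose
  volume is inversely proportional to the weight. A Gaussian smoothing compares its probability
  with the small-ball bound (`measure_parallelepiped_mul_det_le`,
  `measure_forall_abs_inner_le_mul_gramSchmidt`). There are `m ^ d` tuples.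
* If `A` has at least `s m` elements, then the weights of the tuples in `A` add up to at least
  `(s m / 2) ^ d`. The weight is a product of distances to the span of the preceding vectors, at
  most one each, so it may be replaced by its square, and it suffices that the squared distances
  from the `v i`, `i ∈ A`, to any subspace `F` with `dim F < d` add up to at least `s m / 2`
  (`pow_le_sum_prod_norm_gramSchmidt_sq`). They add up to `|A| - ∑ ‖P_F (v i)‖²`, and the last sum
  is at most `‖T‖_{S_q}² (dim F) ^ (1 / p) ≤ s m / 2` by the spectral theorem and Hölder's
  inequality (`exists_orthonormalBasis_sum_norm_starProjection_adjoint_sq`,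
  `sum_sq_singularValues_mul_le`).

Markov's inequality (`measure_card_small_mul_pow_le`) bounds the probability by
`(2 C L θ / s) ^ d`. This implies the claim, even with `c_q` independent of `q`: the stable rank is
at most the rank, so that `d ≤ n - 1` and the factor in front of the power is at least one.
-/

/-! ### Anti-concentration on parallelepipeds -/

lemma integral_cube_mul_of_ne {ι : Type*} [Fintype ι] [DecidableEq ι] (θ : ℝ) {j k : ι}
    (hjk : j ≠ k) :
    ∫ x in Set.Icc (fun _ : ι => -θ) (fun _ => θ), x j * x k = 0 := by
  have h := integral_fintype_prod_eq_prod (𝕜 := ℝ)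
    (μ := fun _ : ι => (volume : Measure ℝ).restrict (Set.Icc (-θ) θ))
    (fun l t => (if l = j then t else 1) * (if l = k then t else 1))
  rw [← Measure.restrict_pi_pi, Set.pi_univ_Icc, ← volume_pi] at h
  have h2 : ∀ x : ι → ℝ, ∏ l, ((if l = j then x l else 1) * (if l = k then x l else 1))
      = x j * x k := by
    intro x
    rw [Finset.prod_mul_distrib]
    simp
  simp only [h2] at h
  rw [h]
  refine Finset.prod_eq_zero (Finset.mem_univ j) ?_
  simp only [if_true, if_neg hjk, mul_one]
  by_cases hθ : -θ ≤ θ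
  · rw [integral_Icc_eq_integral_Ioc, ← intervalIntegral.integral_of_le hθ]
    simp
  · simp [Set.Icc_eq_empty hθ]

lemma volume_cube {ι : Type*} [Fintype ι] {θ : ℝ} :
    (volume : Measure (ι → ℝ)) (Set.Icc (fun _ => -θ) (fun _ => θ))
      = ENNReal.ofReal (2 * θ) ^ Fintype.card ι := by
  rw [Real.volume_Icc_pi]
  simp [two_mul]

lemma integral_cube_sq_le {ι : Type*} [Fintype ι] {θ : ℝ} (hθ : 0 < θ)
    (w : ι → ℝ) (hw : ∑ j, w j ^ 2 ≤ 1) :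
    ∫ x in Set.Icc (fun _ : ι => -θ) (fun _ => θ), (∑ j, w j * x j) ^ 2
      ≤ θ ^ 2 * (2 * θ) ^ Fintype.card ι := by
  classical
  have hint : ∀ f : (ι → ℝ) → ℝ, Continuous f →
      IntegrableOn f (Set.Icc (fun _ : ι => -θ) (fun _ => θ)) :=
    fun f hf => hf.integrableOn_Icc
  have h1 : ∀ x : ι → ℝ, (∑ j, w j * x j) ^ 2 = ∑ j, ∑ k, (w j * w k) * (x j * x k) := by
    intro x
    rw [sq, Finset.sum_mul_sum]
    exact Finset.sum_congr rfl fun j _ => Finset.sum_congr rfl fun k _ => by ring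
  simp only [h1]
  rw [integral_finsetSum _ fun j _ => hint _ (by fun_prop)]
  have h2 : ∀ j, ∫ x in Set.Icc (fun _ : ι => -θ) (fun _ => θ),
      ∑ k, (w j * w k) * (x j * x k) ≤ w j ^ 2 * (θ ^ 2 * (2 * θ) ^ Fintype.card ι) := by
    intro j
    rw [integral_finsetSum _ fun j _ => hint _ (by fun_prop), Finset.sum_eq_single j]
    · rw [integral_const_mul, ← sq]
      refine mul_le_mul_of_nonneg_left ?_ (sq_nonneg _)
      calc ∫ x in Set.Icc (fun _ : ι => -θ) (fun _ => θ), x j * x j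
          ≤ ∫ x in Set.Icc (fun _ : ι => -θ) (fun _ => θ), θ ^ 2 := by
            refine setIntegral_mono_on (hint _ (by fun_prop)) (hint _ (by fun_prop))
              measurableSet_Icc fun x hx => ?_
            have := hx.1 j
            have := hx.2 j
            simp only at *
            nlinarith
        _ = θ ^ 2 * (2 * θ) ^ Fintype.card ι := by
            rw [setIntegral_const, Measure.real, volume_cube, ENNReal.toReal_pow,
              ENNReal.toReal_ofReal (by positivity), smul_eq_mul, mul_comm]
    · intro k _ hk
      rw [integral_const_mul, integral_cube_mul_of_ne θ hk.symm, mul_zero]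
    · simp
  calc _ ≤ ∑ j, w j ^ 2 * (θ ^ 2 * (2 * θ) ^ Fintype.card ι) := Finset.sum_le_sum fun j _ => h2 j
    _ = (∑ j, w j ^ 2) * (θ ^ 2 * (2 * θ) ^ Fintype.card ι) := by rw [Finset.sum_mul]
    _ ≤ _ := mul_le_of_le_one_left (by positivity) hw

/-- A lower bound for the Gaussian weight averaged over the cube, by the tangent-line form of
Jensen's inequality: `∑ i, ((α i - (W x) i) / θ) ^ 2` is at most `2 N + 2 ∑ i, ((W x) i / θ) ^ 2`
with `N = card ι`, and its average over the cube is at most `4 N`. -/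
lemma lintegral_cube_exp_ge {ι : Type*} [Fintype ι] {θ : ℝ} (hθ : 0 < θ)
    (W : Matrix ι ι ℝ) (hW : ∀ i, ∑ j, W i j ^ 2 ≤ 1) (α : ι → ℝ) (hα : ∀ i, |α i| ≤ θ) :
    ENNReal.ofReal (Real.exp (-4) ^ Fintype.card ι * (2 * θ) ^ Fintype.card ι) ≤
      ∫⁻ x in Set.Icc (fun _ : ι => -θ) (fun _ => θ),
        ENNReal.ofReal (∏ i, Real.exp (-((α i - (W.mulVec x) i) / θ) ^ 2)) := by
  set Q := Set.Icc (fun _ : ι => -θ) (fun _ => θ)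
  set N := Fintype.card ι
  have hint : ∀ f : (ι → ℝ) → ℝ, Continuous f → IntegrableOn f Q :=
    fun f hf => hf.integrableOn_Icc
  have hvol : ∀ a : ℝ, ∫ x in Q, a = a * (2 * θ) ^ N := fun a => by
    rw [setIntegral_const, Measure.real, volume_cube, ENNReal.toReal_pow,
      ENNReal.toReal_ofReal (by positivity), smul_eq_mul, mul_comm]
  have hcont : Continuous fun x : ι → ℝ => ∏ i, Real.exp (-((α i - (W.mulVec x) i) / θ) ^ 2) := by
    simp only [Matrix.mulVec, dotProduct]
    fun_prop
  rw [← ofReal_integral_eq_lintegral_ofReal (hint _ hcont)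
    (Filter.Eventually.of_forall fun x => by positivity)]
  refine ENNReal.ofReal_le_ofReal ?_
  have hpt : ∀ x : ι → ℝ, Real.exp (-4) ^ N *
      (1 + 2 * N - 2 / θ ^ 2 * ∑ i, (∑ j, W i j * x j) ^ 2)
        ≤ ∏ i, Real.exp (-((α i - (W.mulVec x) i) / θ) ^ 2) := by
    intro x
    rw [← Real.exp_sum, ← Real.exp_nat_mul]
    -- `(α - β)² ≤ 2 α² + 2 β²` and `|α| ≤ θ`, then `1 + t ≤ exp t`
    set S := ∑ i, (∑ j, W i j * x j) ^ 2
    have h1 : (∑ i, -((α i - (W.mulVec x) i) / θ) ^ 2) ≥ -(2 * N) - 2 / θ ^ 2 * S := by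
      have : ∀ i, -((α i - (W.mulVec x) i) / θ) ^ 2
          ≥ -2 - 2 / θ ^ 2 * (∑ j, W i j * x j) ^ 2 := by
        intro i
        have e : (W.mulVec x) i = ∑ j, W i j * x j := rfl
        rw [e]
        set β := ∑ j, W i j * x j
        have h3 : α i ^ 2 ≤ θ ^ 2 := sq_le_sq' (abs_le.1 (hα i)).1 (abs_le.1 (hα i)).2
        have h4 : (α i - β) ^ 2 ≤ 2 * θ ^ 2 + 2 * β ^ 2 := by nlinarith [sq_nonneg (α i + β)]
        have h5 : ((α i - β) / θ) ^ 2 ≤ (2 * θ ^ 2 + 2 * β ^ 2) / θ ^ 2 := by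
          rw [div_pow]; gcongr
        have h6 : (2 * θ ^ 2 + 2 * β ^ 2) / θ ^ 2 = 2 + 2 / θ ^ 2 * β ^ 2 := by
          field_simp
        linarith
      calc (∑ i, -((α i - (W.mulVec x) i) / θ) ^ 2)
          ≥ ∑ i, (-2 - 2 / θ ^ 2 * (∑ j, W i j * x j) ^ 2) := Finset.sum_le_sum fun i _ => this i
        _ = _ := by
          rw [Finset.sum_sub_distrib, ← Finset.mul_sum]
          simp [N, S]; ring
    calc Real.exp (N * -4) * (1 + 2 * N - 2 / θ ^ 2 * S)
        ≤ Real.exp (N * -4) * Real.exp (2 * N - 2 / θ ^ 2 * S) := by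
          gcongr
          linarith [Real.add_one_le_exp (2 * N - 2 / θ ^ 2 * S)]
      _ = Real.exp (-(2 * N) - 2 / θ ^ 2 * S) := by rw [← Real.exp_add]; ring_nf
      _ ≤ _ := Real.exp_le_exp.2 h1
  have hS : ∫ x in Q, ∑ i, (∑ j, W i j * x j) ^ 2 ≤ N * (θ ^ 2 * (2 * θ) ^ N) := by
    rw [integral_finsetSum _ fun j _ => hint _ (by fun_prop)]
    calc _ ≤ ∑ i : ι, θ ^ 2 * (2 * θ) ^ N :=
          Finset.sum_le_sum fun i _ => integral_cube_sq_le hθ _ (hW i)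
      _ = _ := by simp [N]
  calc Real.exp (-4) ^ N * (2 * θ) ^ N
      ≤ Real.exp (-4) ^ N * ((1 + 2 * N) * (2 * θ) ^ N
          - 2 / θ ^ 2 * ∫ x in Q, ∑ i, (∑ j, W i j * x j) ^ 2) := by
        gcongr
        have : 2 / θ ^ 2 * ∫ x in Q, ∑ i, (∑ j, W i j * x j) ^ 2
            ≤ 2 / θ ^ 2 * (N * (θ ^ 2 * (2 * θ) ^ N)) := by gcongr
        have e : 2 / θ ^ 2 * (N * (θ ^ 2 * (2 * θ) ^ N)) = 2 * N * (2 * θ) ^ N := by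
          field_simp
        linarith
    _ = ∫ x in Q, Real.exp (-4) ^ N *
      (1 + 2 * N - 2 / θ ^ 2 * ∑ i, (∑ j, W i j * x j) ^ 2) := by
        rw [integral_const_mul, integral_sub (hint _ (by fun_prop)) (hint _ (by fun_prop)),
          hvol, integral_const_mul]
    _ ≤ _ := integral_mono (hint _ (by fun_prop)) (hint _ hcont) hpt

lemma lintegral_exp_mulVec {ι : Type*} [Fintype ι] [DecidableEq ι] {θ : ℝ} (hθ : 0 < θ)
    (W : Matrix ι ι ℝ) (hW : W.det ≠ 0) :
    ∫⁻ z : ι → ℝ, ENNReal.ofReal (∏ i, Real.exp (-((W.mulVec z) i / θ) ^ 2))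
      = ENNReal.ofReal (|W.det|⁻¹ * (√Real.pi * θ) ^ Fintype.card ι) := by
  have hm : Measurable fun y : ι → ℝ => ENNReal.ofReal (∏ i, Real.exp (-(y i / θ) ^ 2)) := by
    fun_prop
  have h := Real.map_matrix_volume_pi_eq_smul_volume_pi hW
  have hl : ∫⁻ z : ι → ℝ, ENNReal.ofReal (∏ i, Real.exp (-((W.mulVec z) i / θ) ^ 2))
      = ∫⁻ y, ENNReal.ofReal (∏ i, Real.exp (-(y i / θ) ^ 2))
        ∂(Measure.map (Matrix.toLin' W) volume) := by
    rw [lintegral_map hm (by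
      exact (LinearMap.continuous_of_finiteDimensional (Matrix.toLin' W)).measurable)]
    simp [Matrix.toLin'_apply]
  have hg : ∀ t : ℝ, Real.exp (-(t / θ) ^ 2) = Real.exp (-(1 / θ ^ 2) * t ^ 2) := by
    intro t; congr 1; rw [div_pow]; ring
  have hi : Integrable fun t : ℝ => Real.exp (-(t / θ) ^ 2) := by
    simp only [hg]
    exact integrable_exp_neg_mul_sq (by positivity)
  have hip : Integrable fun y : ι → ℝ => ∏ i, Real.exp (-(y i / θ) ^ 2) :=
    Integrable.fintype_prod fun _ => hi
  rw [hl, h, lintegral_smul_measure, ← ofReal_integral_eq_lintegral_ofReal hip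
    (Filter.Eventually.of_forall fun x => by positivity),
    integral_fintype_prod_volume_eq_pow (fun t : ℝ => Real.exp (-(t / θ) ^ 2))]
  simp only [hg]
  rw [integral_gaussian, smul_eq_mul, ← ENNReal.ofReal_mul (by positivity), abs_inv]
  congr 3
  rw [div_div_eq_mul_div, div_one, Real.sqrt_mul Real.pi_pos.le, Real.sqrt_sq hθ.le]

/-- If every translate of the cube `[-θ, θ]^ι` has probability at most `κ` for the vector `Y`, then
the parallelepiped `{|(W y) i| ≤ θ}` has probability at most `C ^ card ι * κ / |det W|`. The
parallelepiped may be much thinner than the cube in some directions; the bound still has the right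
dependence on its volume because the rows of `W` have norm at most one. For the proof,
integrate the Gaussian weight `h z = exp (-‖W z‖² / θ²)` against `ν (Y - z ∈ cube)` in the two
possible orders. -/
lemma measure_parallelepiped_mul_det_le {α ι : Type*} [Fintype ι] [DecidableEq ι]
    [MeasurableSpace α] (ν : Measure α) [SFinite ν] {θ : ℝ} (hθ : 0 < θ)
    (Y : α → ι → ℝ) (hY : Measurable Y) (κ : ℝ≥0∞)
    (hκ : ∀ z : ι → ℝ, ν {x | ∀ j, |Y x j - z j| ≤ θ} ≤ κ)
    (W : Matrix ι ι ℝ) (hW : ∀ i, ∑ j, W i j ^ 2 ≤ 1) :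
    ν {x | ∀ i, |(W.mulVec (Y x)) i| ≤ θ} * ENNReal.ofReal |W.det|
      ≤ ENNReal.ofReal (Real.exp 4) ^ Fintype.card ι * κ := by
  by_cases hdet : W.det = 0
  · simp [hdet]
  set N := Fintype.card ι
  set Q := Set.Icc (fun _ : ι => -θ) (fun _ => θ)
  set S := {x | ∀ i, |(W.mulVec (Y x)) i| ≤ θ}
  let h : (ι → ℝ) → ℝ≥0∞ := fun z => ENNReal.ofReal (∏ i, Real.exp (-((W.mulVec z) i / θ) ^ 2))
  have hh : Measurable h := by
    simp only [h, Matrix.mulVec, dotProduct]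
    fun_prop
  have hS : MeasurableSet S := by
    have : S = ⋂ i, {x | |(W.mulVec (Y x)) i| ≤ θ} := by ext; simp [S]
    rw [this]
    refine MeasurableSet.iInter fun i => ?_
    simp only [Matrix.mulVec, dotProduct]
    measurability
  have hQ : MeasurableSet Q := measurableSet_Icc
  let g : α → (ι → ℝ) → ℝ≥0∞ := fun x z => h z * Q.indicator 1 (Y x - z)
  have hgm : Measurable (Function.uncurry g) := by
    refine (hh.comp measurable_snd).mul ?_
    exact (measurable_one.indicator hQ).comp ((hY.comp measurable_fst).sub measurable_snd)
  have lower : ENNReal.ofReal (Real.exp (-4) ^ N * (2 * θ) ^ N) * ν S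
      ≤ ∫⁻ x, ∫⁻ z, g x z ∂volume ∂ν := by
    rw [← setLIntegral_const]
    refine (setLIntegral_mono' hS fun x hx => ?_).trans (setLIntegral_le_lintegral S _)
    refine (lintegral_cube_exp_ge hθ W hW _ hx).trans (le_of_eq ?_)
    -- substitute `z = Y x - z'`, with `z'` in the cube
    rw [← lintegral_sub_left_eq_self (g x) (Y x), ← lintegral_indicator hQ]
    congr 1
    ext z
    by_cases hz : z ∈ Q
    · simp [g, h, hz, Matrix.mulVec_sub]
    · simp [g, hz]
  have upper : ∫⁻ x, ∫⁻ z, g x z ∂volume ∂ν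
      ≤ κ * ENNReal.ofReal (|W.det|⁻¹ * (√Real.pi * θ) ^ N) := by
    rw [lintegral_lintegral_swap hgm.aemeasurable, ← lintegral_exp_mulVec hθ W hdet,
      ← lintegral_const_mul _ hh]
    refine lintegral_mono fun z => ?_
    have hind : Measurable fun x => Q.indicator (1 : (ι → ℝ) → ℝ≥0∞) (Y x - z) :=
      (measurable_one.indicator hQ).comp (hY.sub measurable_const)
    change ∫⁻ x, h z * Q.indicator 1 (Y x - z) ∂ν ≤ κ * h z
    rw [lintegral_const_mul _ hind, mul_comm]
    refine mul_le_mul_left (le_trans (le_of_eq ?_) (hκ z)) _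
    have hset : MeasurableSet {x | ∀ j, |Y x j - z j| ≤ θ} := by
      have : {x | ∀ j, |Y x j - z j| ≤ θ} = ⋂ j, {x | |Y x j - z j| ≤ θ} := by ext; simp
      rw [this]
      refine MeasurableSet.iInter fun i => ?_
      measurability
    rw [← lintegral_indicator_one hset]
    congr 1
    ext x
    simp only [Set.indicator, Q, Set.mem_Icc, Pi.le_def, Set.mem_ofPred_eq, Pi.sub_apply, abs_le,
      forall_and]
    rfl
  have key := lower.trans upper
  have hD : 0 < |W.det| := abs_pos.2 hdet
  have e4 : Real.exp 4 * Real.exp (-4) = 1 := by rw [← Real.exp_add]; simp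
  have hpi : √Real.pi ≤ 2 := by
    rw [Real.sqrt_le_left (by norm_num)]
    linarith [Real.pi_le_four]
  set a := ENNReal.ofReal (Real.exp (-4) ^ N * (2 * θ) ^ N)
  set D := ENNReal.ofReal |W.det|
  have ha0 : a ≠ 0 := by simp only [a, ne_eq, ENNReal.ofReal_eq_zero, not_le]; positivity
  have hat : a ≠ ∞ := ENNReal.ofReal_ne_top
  have h1 : D * ENNReal.ofReal (|W.det|⁻¹ * (√Real.pi * θ) ^ N)
      ≤ a * ENNReal.ofReal (Real.exp 4) ^ N := by
    rw [← ENNReal.ofReal_pow (Real.exp_pos _).le, ← ENNReal.ofReal_mul (abs_nonneg _),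
      ← ENNReal.ofReal_mul (by positivity)]
    refine ENNReal.ofReal_le_ofReal ?_
    rw [← mul_assoc, mul_inv_cancel₀ hD.ne', one_mul, mul_right_comm, ← mul_pow,
      mul_comm (Real.exp (-4)), e4, one_pow, one_mul]
    gcongr
  refine (ENNReal.mul_le_mul_iff_right ha0 hat).1 ?_
  calc a * (ν S * D) = (a * ν S) * D := by ring
    _ ≤ (κ * ENNReal.ofReal (|W.det|⁻¹ * (√Real.pi * θ) ^ N)) * D := by gcongr
    _ = κ * (D * ENNReal.ofReal (|W.det|⁻¹ * (√Real.pi * θ) ^ N)) := by ring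
    _ ≤ κ * (a * ENNReal.ofReal (Real.exp 4) ^ N) := by gcongr
    _ = _ := by ring

/-! ### Gram–Schmidt volumes of tuples -/

lemma starProjection_span_range_eq_sum {ι E : Type*} [Fintype ι] [NormedAddCommGroup E]
    [InnerProductSpace ℝ E] [FiniteDimensional ℝ E] {b : ι → E} (hb : Orthonormal ℝ b) (u : E) :
    (Submodule.span ℝ (Set.range b)).starProjection u = ∑ j, inner ℝ (b j) u • b j := by
  classical
  refine Submodule.eq_starProjection_of_mem_of_inner_eq_zero
    ?_ ?_
  · exact Submodule.sum_mem _ fun j _ =>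
      Submodule.smul_mem _ _ (Submodule.subset_span (Set.mem_range_self j))
  intro w hw
  induction hw using Submodule.span_induction with
  | mem x hx =>
    obtain ⟨j, rfl⟩ := hx
    rw [inner_sub_left, real_inner_comm, sub_eq_zero, real_inner_comm (b j),
      hb.inner_right_fintype]
  | zero => simp
  | add x y _ _ hx hy => rw [inner_add_right, hx, hy, add_zero]
  | smul a x _ hx => rw [inner_smul_right, hx, mul_zero]

lemma norm_starProjection_span_range_sq {ι E : Type*} [Fintype ι] [NormedAddCommGroup E]
    [InnerProductSpace ℝ E] [FiniteDimensional ℝ E] {b : ι → E} (hb : Orthonormal ℝ b) (u : E) :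
    ‖(Submodule.span ℝ (Set.range b)).starProjection u‖ ^ 2 = ∑ j, inner ℝ (b j) u ^ 2 := by
  rw [starProjection_span_range_eq_sum hb, ← real_inner_self_eq_norm_sq, hb.inner_sum]
  simp [sq]

lemma norm_starProjection_sq_eq_sum {E : Type*} [NormedAddCommGroup E] [InnerProductSpace ℝ E]
    [FiniteDimensional ℝ E] (F : Submodule ℝ E) (y : E) :
    ‖F.starProjection y‖ ^ 2 = ∑ l, inner ℝ (stdOrthonormalBasis ℝ F l : E) y ^ 2 := by
  rw [Submodule.starProjection_apply, ← Submodule.coe_norm,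
    ← (stdOrthonormalBasis ℝ F).sum_sq_inner_right]
  simp

/-- The trace of an orthogonal projection is its rank. -/
lemma sum_norm_starProjection_sq {E ι : Type*} [NormedAddCommGroup E] [InnerProductSpace ℝ E]
    [FiniteDimensional ℝ E] [Fintype ι] (e : OrthonormalBasis ι ℝ E) (F : Submodule ℝ E) :
    ∑ r, ‖F.starProjection (e r)‖ ^ 2 = Module.finrank ℝ F := by
  have h (l) : ‖(stdOrthonormalBasis ℝ F l : E)‖ = 1 := by
    rw [← Submodule.coe_norm, OrthonormalBasis.norm_eq_one]
  simp only [norm_starProjection_sq_eq_sum]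
  rw [Finset.sum_comm]
  simp [e.sum_sq_inner_left, h]

open InnerProductSpace in
lemma inner_gramSchmidt_self {E : Type*} [NormedAddCommGroup E] [InnerProductSpace ℝ E] {d : ℕ}
    (v : Fin d → E) (i : Fin d) :
    inner ℝ (gramSchmidt ℝ v i) (v i) = ‖gramSchmidt ℝ v i‖ ^ 2 := by
  conv_lhs => rw [gramSchmidt_def'' ℝ v i]
  rw [inner_add_right, inner_sum, Finset.sum_eq_zero, add_zero, real_inner_self_eq_norm_sq]
  intro k hk
  rw [inner_smul_right, gramSchmidt_orthogonal ℝ v (Finset.mem_Iio.1 hk).ne', mul_zero]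

open InnerProductSpace in
lemma norm_gramSchmidt_le {E : Type*} [NormedAddCommGroup E] [InnerProductSpace ℝ E] {d : ℕ}
    (v : Fin d → E) (i : Fin d) : ‖gramSchmidt ℝ v i‖ ≤ ‖v i‖ := by
  have h := real_inner_le_norm (gramSchmidt ℝ v i) (v i)
  rw [inner_gramSchmidt_self] at h
  by_contra! hlt
  have := (norm_nonneg _).trans_lt hlt
  nlinarith

open InnerProductSpace in
/-- A small-ball bound for the balls of radius `θ √d` in all `d`-dimensional subspaces gives one for
the slab intersection `{|⟪v i, x⟫| ≤ θ}`, weighted by the volume of the parallelepiped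
spanned by `v`, which is the product of the Gram–Schmidt residues. -/
lemma measure_forall_abs_inner_le_mul_gramSchmidt {E : Type*} [NormedAddCommGroup E]
    [InnerProductSpace ℝ E] [FiniteDimensional ℝ E] [MeasurableSpace E] [BorelSpace E]
    (ν : Measure E) [SFinite ν] {θ : ℝ} (hθ : 0 < θ) {d : ℕ} (v : Fin d → E)
    (hv : ∀ i, ‖v i‖ ≤ 1) (κ : ℝ≥0∞)
    (hκ : ∀ F : Submodule ℝ E, Module.finrank ℝ F = d → ∀ z : E,
      ν {x | ‖F.starProjection x - z‖ ≤ θ * √(d : ℝ)} ≤ κ) :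
    ν {x | ∀ i, |inner ℝ (v i) x| ≤ θ} * ENNReal.ofReal (∏ i, ‖gramSchmidt ℝ v i‖)
      ≤ ENNReal.ofReal (Real.exp 4) ^ d * κ := by
  -- if `v` is linearly dependent, the left-hand side vanishes
  by_cases h0 : ∃ i, gramSchmidt ℝ v i = 0
  · obtain ⟨i, hi⟩ := h0
    rw [Finset.prod_eq_zero (Finset.mem_univ i) (by rw [hi, norm_zero])]
    simp
  push Not at h0
  set b := gramSchmidtNormed ℝ v with hbdef
  have hbs : ∀ i, b i = ‖gramSchmidt ℝ v i‖⁻¹ • gramSchmidt ℝ v i := fun i => rfl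
  have hb : Orthonormal ℝ b := by
    refine ⟨fun i => gramSchmidtNormed_unit_length' ?_, fun i j hij => ?_⟩
    · rw [← hbdef, hbs]
      exact smul_ne_zero (inv_ne_zero (norm_ne_zero_iff.2 (h0 i))) (h0 i)
    · change inner ℝ (b i) (b j) = 0
      rw [hbs, hbs, inner_smul_left, inner_smul_right, gramSchmidt_orthogonal ℝ v hij]
      simp
  have hspan : Submodule.span ℝ (Set.range b) = Submodule.span ℝ (Set.range v) := by
    rw [hbdef, span_gramSchmidtNormed_range, span_gramSchmidt]
  have hfin : Module.finrank ℝ (Submodule.span ℝ (Set.range b)) = d := by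
    rw [finrank_span_eq_card hb.linearIndependent, Fintype.card_fin]
  let W : Matrix (Fin d) (Fin d) ℝ := Matrix.of fun i j => inner ℝ (b j) (v i)
  have hWrow : ∀ i, ∑ j, W i j ^ 2 ≤ 1 := by
    intro i
    have h1 := norm_starProjection_span_range_sq hb (v i)
    have h2 := Submodule.norm_starProjection_apply_le (Submodule.span ℝ (Set.range b)) (v i)
    have h3 := hv i
    simp only [W, Matrix.of_apply]
    rw [← h1]
    exact pow_le_one₀ (norm_nonneg _) (h2.trans h3)
  have hWdet : W.det = ∏ i, ‖gramSchmidt ℝ v i‖ := by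
    rw [Matrix.det_of_isLowerTriangular]
    · refine Finset.prod_congr rfl fun i _ => ?_
      simp only [W, Matrix.of_apply]
      rw [hbs, inner_smul_left, inner_gramSchmidt_self]
      have := norm_ne_zero_iff.2 (h0 i)
      simp
      field_simp
    · intro i j hij
      simp only [W, Matrix.of_apply]
      rw [hbs, inner_smul_left, gramSchmidt_inv_triangular ℝ v (by simpa using hij), mul_zero]
  have hvi : ∀ i x, W.mulVec (fun j => inner ℝ (b j) x) i = inner ℝ (v i) x := by
    intro i x
    have hmem : v i ∈ Submodule.span ℝ (Set.range b) := by
      rw [hspan]; exact Submodule.subset_span ⟨i, rfl⟩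
    have h1 := starProjection_span_range_eq_sum hb (v i)
    rw [Submodule.starProjection_eq_self_iff.2 hmem] at h1
    conv_rhs => rw [h1]
    rw [sum_inner]
    simp [Matrix.mulVec, dotProduct, W, inner_smul_left]
  have key := measure_parallelepiped_mul_det_le ν hθ (fun x j => inner ℝ (b j) x)
    (by fun_prop) κ ?_ W hWrow
  · simp only [hvi] at key
    rwa [hWdet, abs_of_nonneg (Finset.prod_nonneg fun i _ => norm_nonneg _),
      Fintype.card_fin] at key
  · -- the cube of half-side `θ` lies in the ball of radius `θ √d`
    intro z
    refine (measure_mono ?_).trans (hκ _ hfin (∑ j, z j • b j))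
    intro x hx
    simp only [Set.mem_ofPred_eq] at hx ⊢
    rw [starProjection_span_range_eq_sum hb, ← Finset.sum_sub_distrib]
    simp only [← sub_smul]
    refine abs_le_of_sq_le_sq' ?_ (by positivity) |>.2
    rw [← real_inner_self_eq_norm_sq, hb.inner_sum, mul_pow, Real.sq_sqrt (by positivity)]
    calc ∑ i, (starRingEnd ℝ) (inner ℝ (b i) x - z i) * (inner ℝ (b i) x - z i)
        ≤ ∑ i : Fin d, θ ^ 2 := Finset.sum_le_sum fun i _ => by
          have := hx i
          rw [abs_le] at this
          simp only [conj_trivial]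
          nlinarith
      _ = θ ^ 2 * d := by simp [mul_comm]

open InnerProductSpace in
lemma gramSchmidt_snoc_castSucc {E : Type*} [NormedAddCommGroup E] [InnerProductSpace ℝ E]
    {d : ℕ} (v : Fin d → E) (x : E) (i : Fin d) :
    gramSchmidt ℝ (Fin.snoc v x : Fin (d + 1) → E) i.castSucc = gramSchmidt ℝ v i := by
  induction i using WellFoundedLT.induction with
  | ind i ih =>
    rw [gramSchmidt_def, gramSchmidt_def, Fin.Iio_castSucc, Finset.sum_map]
    congr 1
    · simp
    · refine Finset.sum_congr rfl fun k hk => ?_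
      simp only [Fin.castSuccEmb_apply, Fin.snoc_castSucc, Submodule.starProjection_singleton]
      rw [ih k (Finset.mem_Iio.1 hk)]

open InnerProductSpace in
/-- The last Gram–Schmidt residue differs from `x` by an element of the span of `v`, hence is at
least as long as the distance from `x` to that span. -/
lemma norm_sub_starProjection_le_gramSchmidt_snoc {E : Type*} [NormedAddCommGroup E]
    [InnerProductSpace ℝ E] [FiniteDimensional ℝ E] {d : ℕ} (v : Fin d → E) (x : E) :
    ‖x - (Submodule.span ℝ (Set.range v)).starProjection x‖
      ≤ ‖gramSchmidt ℝ (Fin.snoc v x : Fin (d + 1) → E) (Fin.last d)‖ := by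
  set F := Submodule.span ℝ (Set.range v)
  have h : ∑ k ∈ Finset.Iio (Fin.last d),
      (ℝ ∙ gramSchmidt ℝ (Fin.snoc v x : Fin (d + 1) → E) k).starProjection x ∈ F := by
    rw [Fin.Iio_last_eq_map, Finset.sum_map]
    refine Submodule.sum_mem _ fun k _ => ?_
    have hk : gramSchmidt ℝ (Fin.snoc v x : Fin (d + 1) → E) (Fin.castSuccEmb k) ∈ F := by
      rw [Fin.castSuccEmb_apply, gramSchmidt_snoc_castSucc]
      simp only [F]
      rw [← span_gramSchmidt ℝ v]
      exact Submodule.subset_span ⟨k, rfl⟩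
    refine (Submodule.span_le.2 (Set.singleton_subset_iff.2 hk))
      (Submodule.starProjection_apply_mem _ _)
  rw [gramSchmidt_def, Submodule.starProjection_minimal]
  simp only [Fin.snoc_last]
  exact ciInf_le ⟨0, by rintro _ ⟨y, rfl⟩; positivity⟩ (⟨_, h⟩ : F)

open InnerProductSpace in
/-- If the vectors `v i` keep total squared distance at least `δ` from every subspace of dimension
less than `d`, then the squared volumes of all `d`-tuples of them, with repetition, sum to at
least `δ ^ d`: each further entry of a tuple contributes a factor `δ`. -/
lemma pow_le_sum_prod_norm_gramSchmidt_sq {E κ : Type*} [NormedAddCommGroup E]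
    [InnerProductSpace ℝ E] [FiniteDimensional ℝ E] [Fintype κ] (v : κ → E) {δ : ℝ} (hδ : 0 ≤ δ)
    (d : ℕ) (h : ∀ F : Submodule ℝ E, Module.finrank ℝ F < d →
      δ ≤ ∑ i, ‖v i - F.starProjection (v i)‖ ^ 2) :
    δ ^ d ≤ ∑ t : Fin d → κ, ∏ l, ‖gramSchmidt ℝ (v ∘ t) l‖ ^ 2 := by
  induction d with
  | zero => simp
  | succ d ih =>
    have ih' := ih fun F hF => h F (hF.trans (Nat.lt_succ_self d))
    rw [← (Fin.snocEquiv fun _ : Fin (d + 1) => κ).sum_comp, Fintype.sum_prod_type_right, pow_succ]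
    calc δ ^ d * δ ≤ (∑ t : Fin d → κ, ∏ l, ‖gramSchmidt ℝ (v ∘ t) l‖ ^ 2) * δ := by gcongr
      _ = ∑ t : Fin d → κ, (∏ l, ‖gramSchmidt ℝ (v ∘ t) l‖ ^ 2) * δ := Finset.sum_mul _ _ _
      _ ≤ _ := Finset.sum_le_sum fun t _ => ?_
    have hF : Module.finrank ℝ (Submodule.span ℝ (Set.range (v ∘ t))) < d + 1 :=
      (finrank_range_le_card (v ∘ t)).trans_lt (by simp)
    calc _ ≤ (∏ l, ‖gramSchmidt ℝ (v ∘ t) l‖ ^ 2) * ∑ i, ‖v i -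
            (Submodule.span ℝ (Set.range (v ∘ t))).starProjection (v i)‖ ^ 2 := by
          gcongr; exact h _ hF
      _ = ∑ i, (∏ l, ‖gramSchmidt ℝ (v ∘ t) l‖ ^ 2) * ‖v i -
            (Submodule.span ℝ (Set.range (v ∘ t))).starProjection (v i)‖ ^ 2 := Finset.mul_sum _ _ _
      _ ≤ _ := Finset.sum_le_sum fun i _ => ?_
    have hsn : v ∘ (Fin.snocEquiv (fun _ : Fin (d + 1) => κ) (i, t)) = Fin.snoc (v ∘ t) (v i) := by
      rw [← Fin.comp_snoc]; rfl
    rw [Fin.prod_univ_castSucc, hsn]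
    simp only [gramSchmidt_snoc_castSucc]
    gcongr
    exact norm_sub_starProjection_le_gramSchmidt_snoc _ _

/-! ### Volume-weighted counting and singular values -/

open InnerProductSpace in
/-- If many coordinates `⟪v i, x⟫` are small, then the volumes of the `d`-tuples of small
coordinates add up to at least `(a - β) ^ d`; in expectation, every tuple contributes at most
`exp 4 ^ d * κ`. This is Markov's inequality for the volume-weighted number of small tuples. -/
lemma measure_card_small_mul_pow_le {E ι : Type*} [NormedAddCommGroup E] [InnerProductSpace ℝ E]
    [FiniteDimensional ℝ E] [MeasurableSpace E] [BorelSpace E] [Fintype ι]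
    (ν : Measure E) [SFinite ν] {θ : ℝ} (hθ : 0 < θ) {d : ℕ} (v : ι → E)
    (hv : ∀ i, ‖v i‖ = 1) (κ : ℝ≥0∞)
    (hκ : ∀ F : Submodule ℝ E, Module.finrank ℝ F = d → ∀ z : E,
      ν {x | ‖F.starProjection x - z‖ ≤ θ * √(d : ℝ)} ≤ κ)
    {a β : ℝ} (hβa : β ≤ a)
    (hβ : ∀ F : Submodule ℝ E, Module.finrank ℝ F < d → ∑ i, ‖F.starProjection (v i)‖ ^ 2 ≤ β) :
    ENNReal.ofReal ((a - β) ^ d) *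
        ν {x | a ≤ ({i : ι | |inner ℝ (v i) x| ≤ θ} : Set ι).ncard}
      ≤ (Fintype.card ι : ℝ≥0∞) ^ d * (ENNReal.ofReal (Real.exp 4) ^ d * κ) := by
  classical
  let w : (Fin d → ι) → ℝ≥0∞ := fun t => ENNReal.ofReal (∏ l, ‖gramSchmidt ℝ (v ∘ t) l‖)
  let P : (Fin d → ι) → Set E := fun t => {x | ∀ l, |inner ℝ ((v ∘ t) l) x| ≤ θ}
  have hP : ∀ t, MeasurableSet (P t) := fun t => by
    have : P t = ⋂ l, {x | |inner ℝ ((v ∘ t) l) x| ≤ θ} := by ext; simp [P]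
    rw [this]
    refine MeasurableSet.iInter fun l => measurableSet_le ?_ measurable_const
    exact (continuous_abs.comp (by fun_prop)).measurable
  let f : E → ℝ≥0∞ := fun x => ∑ t, w t * (P t).indicator 1 x
  have hfm : Measurable f :=
    Finset.measurable_sum _ fun t _ => (measurable_one.indicator (hP t)).const_mul _
  have hlow : ∀ x, a ≤ ({i : ι | |inner ℝ (v i) x| ≤ θ} : Set ι).ncard →
      ENNReal.ofReal ((a - β) ^ d) ≤ f x := by
    intro x hx
    let A : Set ι := {i : ι | |inner ℝ (v i) x| ≤ θ}
    have h1 := pow_le_sum_prod_norm_gramSchmidt_sq (fun i : A => v i) (sub_nonneg.2 hβa) d ?_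
    · let emb : (Fin d → A) ↪ (Fin d → ι) :=
        ⟨fun t l => t l, fun t t' h => funext fun l => Subtype.ext (congrFun h l)⟩
      calc ENNReal.ofReal ((a - β) ^ d)
          ≤ ENNReal.ofReal (∑ t : Fin d → A,
              ∏ l, ‖gramSchmidt ℝ ((fun i : A => v i) ∘ t) l‖ ^ 2) := ENNReal.ofReal_le_ofReal h1
        _ = ∑ t : Fin d → A,
              ENNReal.ofReal (∏ l, ‖gramSchmidt ℝ ((fun i : A => v i) ∘ t) l‖ ^ 2) :=
            ENNReal.ofReal_sum_of_nonneg fun t _ => by positivity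
        _ ≤ ∑ t : Fin d → A, w (emb t) * (P (emb t)).indicator 1 x := by
            refine Finset.sum_le_sum fun t _ => ?_
            have hx : x ∈ P (emb t) := fun l => (t l).2
            rw [Set.indicator_of_mem hx, Pi.one_apply, mul_one]
            refine ENNReal.ofReal_le_ofReal (Finset.prod_le_prod (fun l _ => by positivity)
              fun l _ => ?_)
            -- unit vectors have residues of length at most one
            exact pow_le_of_le_one (norm_nonneg _)
              ((norm_gramSchmidt_le _ _).trans_eq (hv _)) two_ne_zero
        _ = ∑ t ∈ Finset.univ.map emb, w t * (P t).indicator 1 x := by rw [Finset.sum_map]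
        _ ≤ f x := Finset.sum_le_sum_of_subset (Finset.subset_univ _)
    · intro F hF
      have h2 : ∀ i, ‖v i - F.starProjection (v i)‖ ^ 2 = 1 - ‖F.starProjection (v i)‖ ^ 2 := by
        intro i
        have := Submodule.norm_sq_eq_add_norm_sq_starProjection (v i) F
        rw [hv, Submodule.starProjection_orthogonal_val] at this
        linarith
      simp only [h2]
      rw [Finset.sum_sub_distrib]
      have h3 : ∑ i : A, ‖F.starProjection (v i)‖ ^ 2 ≤ β := by
        refine le_trans ?_ (hβ F hF)
        refine (Finset.sum_map Finset.univ (Function.Embedding.subtype (· ∈ A))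
          fun i => ‖F.starProjection (v i)‖ ^ 2).symm.le.trans ?_
        exact Finset.sum_le_univ_sum_of_nonneg fun i => by positivity
      have h4 : ∑ i : A, (1 : ℝ) = A.ncard := by
        rw [← Nat.card_coe_set_eq, Nat.card_eq_fintype_card]
        simp
      rw [h4]
      linarith
  calc _ ≤ ENNReal.ofReal ((a - β) ^ d) * ν {x | ENNReal.ofReal ((a - β) ^ d) ≤ f x} :=
        mul_le_mul' le_rfl (measure_mono hlow)
    _ ≤ ∫⁻ x, f x ∂ν := mul_meas_ge_le_lintegral hfm _
    _ = ∑ t, ν (P t) * w t := by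
        rw [lintegral_finsetSum _
          fun t _ => (measurable_one.indicator (hP t)).const_mul _]
        refine Finset.sum_congr rfl fun t _ => ?_
        rw [lintegral_const_mul _ (measurable_one.indicator (hP t)),
          lintegral_indicator_one (hP t), mul_comm]
    _ ≤ ∑ t : Fin d → ι, ENNReal.ofReal (Real.exp 4) ^ d * κ := Finset.sum_le_sum fun t _ =>
        measure_forall_abs_inner_le_mul_gramSchmidt ν hθ _ (fun l => (hv _).le) κ hκ
    _ = _ := by simp

/-- Both sides are the squared Hilbert–Schmidt norm of `T` restricted to `F`; the basis `e` consists
of eigenvectors of `T* T`. -/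
lemma exists_orthonormalBasis_sum_norm_starProjection_adjoint_sq {n m : ℕ}
    (u : OrthonormalBasis (Fin m) ℝ (EuclideanSpace ℝ (Fin m)))
    (T : EuclideanSpace ℝ (Fin n) →ₗ[ℝ] EuclideanSpace ℝ (Fin m)) :
    ∃ e : OrthonormalBasis (Fin n) ℝ (EuclideanSpace ℝ (Fin n)),
      ∀ F : Submodule ℝ (EuclideanSpace ℝ (Fin n)),
        ∑ i, ‖F.starProjection (LinearMap.adjoint T (u i))‖ ^ 2
          = ∑ r : Fin n, T.singularValues r ^ 2 * ‖F.starProjection (e r)‖ ^ 2 := by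
  have hn : Module.finrank ℝ (EuclideanSpace ℝ (Fin n)) = n := by simp
  set e := T.isSymmetric_adjoint_comp_self.eigenvectorBasis hn
  refine ⟨e, fun F => ?_⟩
  have hT : ∀ y, ‖T y‖ ^ 2 = ∑ r : Fin n, T.singularValues r ^ 2 * inner ℝ y (e r) ^ 2 := by
    intro y
    rw [← real_inner_self_eq_norm_sq, ← LinearMap.adjoint_inner_right, ← e.sum_inner_mul_inner]
    refine Finset.sum_congr rfl fun r _ => ?_
    have h1 : inner ℝ (e r) (LinearMap.adjoint T (T y))
        = T.singularValues r ^ 2 * inner ℝ (e r) y := by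
      have := T.isSymmetric_adjoint_comp_self (e r) y
      simp only [LinearMap.comp_apply] at this
      rw [← this, ← LinearMap.comp_apply]
      simp only [e]
      rw [LinearMap.IsSymmetric.apply_eigenvectorBasis, inner_smul_left,
        T.sq_singularValues_fin hn]
      simp
    rw [h1, real_inner_comm]
    ring
  simp only [norm_starProjection_sq_eq_sum F]
  set f := stdOrthonormalBasis ℝ F
  calc ∑ i, ∑ l, inner ℝ (f l : EuclideanSpace ℝ (Fin n)) (LinearMap.adjoint T (u i)) ^ 2
      = ∑ l, ‖T (f l)‖ ^ 2 := by
        rw [Finset.sum_comm]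
        refine Finset.sum_congr rfl fun l _ => ?_
        rw [← u.sum_sq_inner_left]
        simp [LinearMap.adjoint_inner_right]
    _ = _ := by
        simp only [hT]
        rw [Finset.sum_comm]
        simp [Finset.mul_sum]

lemma one_le_stableExponent {q : ℝ≥0∞} (hq : 2 < q) : 1 ≤ stableExponent q := by
  unfold stableExponent
  split_ifs with h
  · exact le_rfl
  · have : 2 < q.toReal := (ENNReal.lt_ofReal_iff_toReal_lt ENNReal.ofNat_ne_top).1
      (by rwa [ENNReal.ofReal_toReal h])
    rw [le_div_iff₀ (by linarith)]
    linarith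

/-- The singular values from index `rank T` on vanish, so they contribute nothing to the sum; this
needs `a ≠ 0` because `0 ^ 0 = 1`. -/
lemma sum_range_finrank_singularValues {n m : ℕ}
    (T : EuclideanSpace ℝ (Fin n) →ₗ[ℝ] EuclideanSpace ℝ (Fin m)) {a : ℝ} (ha : 0 < a) :
    ∑ i ∈ Finset.range (Module.finrank ℝ T.range), T.singularValues i ^ a
      = ∑ r : Fin n, T.singularValues r ^ a := by
  have hr : Module.finrank ℝ T.range ≤ n := by
    simpa using LinearMap.finrank_range_le T
  rw [Fin.sum_univ_eq_sum_range fun i => T.singularValues i ^ a]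
  refine Finset.sum_subset (Finset.range_subset_range.2 hr) fun i _ hi => ?_
  rw [T.singularValues_eq_zero_iff_le_finrank_range.2 (by simpa using hi),
    Real.zero_rpow ha.ne']

lemma schattenNorm_nonneg {n m : ℕ}
    (T : EuclideanSpace ℝ (Fin n) →ₗ[ℝ] EuclideanSpace ℝ (Fin m)) (q : ℝ≥0∞) :
    0 ≤ schattenNorm T q := by
  unfold schattenNorm
  split_ifs
  · exact T.singularValues_nonneg 0
  · have : ∀ i, 0 ≤ T.singularValues i := T.singularValues_nonneg
    exact Real.rpow_nonneg (Finset.sum_nonneg fun i _ => Real.rpow_nonneg (this i) _) _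

lemma schattenNorm_two_sq {n m : ℕ}
    (T : EuclideanSpace ℝ (Fin n) →ₗ[ℝ] EuclideanSpace ℝ (Fin m)) :
    schattenNorm T 2 ^ 2 = ∑ r : Fin n, T.singularValues r ^ 2 := by
  unfold schattenNorm
  rw [if_neg ENNReal.ofNat_ne_top, sum_range_finrank_singularValues T (by simp)]
  simp only [ENNReal.toReal_ofNat, Real.rpow_two]
  rw [← Real.sqrt_eq_rpow, Real.sq_sqrt (by positivity)]

/-- Hölder's inequality with the conjugate exponents `q / 2` and `q / (q - 2)`, the weights `a r`
being at most one. -/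
lemma sum_sq_singularValues_mul_le {n m : ℕ}
    (T : EuclideanSpace ℝ (Fin n) →ₗ[ℝ] EuclideanSpace ℝ (Fin m)) {q : ℝ≥0∞} (hq : 2 < q)
    (a : Fin n → ℝ) (ha0 : ∀ r, 0 ≤ a r) (ha1 : ∀ r, a r ≤ 1) :
    ∑ r : Fin n, T.singularValues r ^ 2 * a r
      ≤ schattenNorm T q ^ 2 * (∑ r, a r) ^ (1 / stableExponent q) := by
  have hs : ∀ i, 0 ≤ T.singularValues i := T.singularValues_nonneg
  by_cases h : q = ∞
  · simp only [schattenNorm, stableExponent, if_pos h, div_one, Real.rpow_one]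
    rw [Finset.mul_sum]
    gcongr with r _
    · exact ha0 r
    · exact hs _
    · exact T.singularValues_antitone (Nat.zero_le _)
  · have hQ : 2 < q.toReal := (ENNReal.lt_ofReal_iff_toReal_lt ENNReal.ofNat_ne_top).1
      (by rwa [ENNReal.ofReal_toReal h])
    simp only [schattenNorm, stableExponent, if_neg h]
    rw [sum_range_finrank_singularValues T (by linarith)]
    set Q := q.toReal
    have hconj : (Q / 2).HolderConjugate (Q / (Q - 2)) := by
      rw [Real.holderConjugate_iff]
      refine ⟨by linarith, ?_⟩
      have : Q - 2 ≠ 0 := by linarith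
      field_simp
      ring
    refine (Real.inner_le_Lp_mul_Lq_of_nonneg Finset.univ hconj
      (f := fun r : Fin n => T.singularValues r ^ 2) (g := a)
      (fun r _ => by positivity) (fun r _ => ha0 r)).trans ?_
    have e1 : ∀ r : Fin n, (T.singularValues r ^ 2) ^ (Q / 2) = T.singularValues r ^ Q := by
      intro r
      rw [← Real.rpow_two, ← Real.rpow_mul (hs _)]
      congr 1; ring
    simp only [e1]
    have e2 : (∑ r : Fin n, T.singularValues r ^ Q) ^ (1 / (Q / 2))
        = ((∑ r : Fin n, T.singularValues r ^ Q) ^ (1 / Q)) ^ 2 := by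
      rw [← Real.rpow_two, ← Real.rpow_mul (Finset.sum_nonneg fun r _ => Real.rpow_nonneg (hs _) _)]
      congr 1; field_simp
    rw [e2]
    have hp : 1 ≤ Q / (Q - 2) := by
      rw [le_div_iff₀ (by linarith)]; linarith
    gcongr with r _
    · exact Finset.sum_nonneg fun r _ => Real.rpow_nonneg (ha0 r) _
    · exact Real.rpow_le_self_of_le_one (ha0 r) (ha1 r) hp

/-! ### The coordinate small-ball estimate -/

lemma stableRank_eq_rpow {n m : ℕ}
    (T : EuclideanSpace ℝ (Fin n) →ₗ[ℝ] EuclideanSpace ℝ (Fin m)) (q : ℝ≥0∞) :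
    stableRank T q = (schattenNorm T 2 ^ 2 / schattenNorm T q ^ 2) ^ stableExponent q := by
  rw [stableRank, Real.rpow_mul (div_nonneg (schattenNorm_nonneg _ _) (schattenNorm_nonneg _ _)),
    Real.rpow_two, div_pow]

/-- Hölder's inequality with the weights equal to one exactly at the nonzero singular values. -/
lemma stableRank_le_finrank_range {n m : ℕ}
    (T : EuclideanSpace ℝ (Fin n) →ₗ[ℝ] EuclideanSpace ℝ (Fin m)) {q : ℝ≥0∞} (hq : 2 < q) :
    stableRank T q ≤ Module.finrank ℝ T.range := by
  have hp := one_le_stableExponent hq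
  set p := stableExponent q
  set k := Module.finrank ℝ T.range
  have hk : k ≤ n := by simpa using LinearMap.finrank_range_le T
  have h := sum_sq_singularValues_mul_le T hq (fun r => if (r : ℕ) < k then 1 else 0)
    (fun r => by split_ifs <;> simp) (fun r => by split_ifs <;> simp)
  have h1 : ∑ r : Fin n, T.singularValues r ^ 2 * (if (r : ℕ) < k then 1 else 0)
      = schattenNorm T 2 ^ 2 := by
    rw [schattenNorm_two_sq]
    refine Finset.sum_congr rfl fun r _ => ?_
    split_ifs with hr
    · rw [mul_one]
    · rw [T.singularValues_eq_zero_iff_le_finrank_range.2 (not_lt.1 hr)]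
      simp
  have h2 : ∑ r : Fin n, (if (r : ℕ) < k then (1 : ℝ) else 0) = k := by
    rw [Fin.sum_univ_eq_sum_range fun i => if i < k then (1 : ℝ) else 0, Finset.sum_ite,
      Finset.sum_const_zero, add_zero, Finset.sum_const, nsmul_eq_mul, mul_one]
    congr 1
    rw [← Finset.card_range k]
    congr 1
    ext i
    simp only [Finset.mem_filter, Finset.mem_range, Finset.card_range]
    omega
  rw [h1, h2] at h
  have h3 : schattenNorm T 2 ^ 2 / schattenNorm T q ^ 2 ≤ (k : ℝ) ^ (1 / p) :=
    div_le_of_le_mul₀ (by positivity) (by positivity) (h.trans_eq (mul_comm _ _))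
  calc stableRank T q = (schattenNorm T 2 ^ 2 / schattenNorm T q ^ 2) ^ p := stableRank_eq_rpow T q
    _ ≤ ((k : ℝ) ^ (1 / p)) ^ p := Real.rpow_le_rpow (by positivity) h3 (by linarith)
    _ = k := by rw [one_div, Real.rpow_inv_rpow (by positivity) (by linarith)]

/-- The small-ball estimate for the law `ν` of the random vector, with absolute constant
`2 * exp 4`. -/
theorem measure_card_small_le {n m : ℕ} (hn : 2 ≤ n) (hm : 1 ≤ m)
    (ν : Measure (EuclideanSpace ℝ (Fin n))) [IsProbabilityMeasure ν] {θ L : ℝ}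
    (hX : WeakSmallBall ν id θ L)
    (u : OrthonormalBasis (Fin m) ℝ (EuclideanSpace ℝ (Fin m)))
    (T : EuclideanSpace ℝ (Fin n) →ₗ[ℝ] EuclideanSpace ℝ (Fin m))
    (hT : ∀ i, ‖LinearMap.adjoint T (u i)‖ = 1) {q : ℝ≥0∞} (hq : 2 < q) {s : ℝ} (hs : 0 < s)
    (hs1 : s < 1) :
    ν.real {x | s * m ≤
        ({i : Fin m | |inner ℝ (LinearMap.adjoint T (u i)) x| ≤ θ} : Set (Fin m)).ncard}
      ≤ 2 * (2 / s) ^ stableExponent q * (m / stableRank T q) *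
        (2 * Real.exp 4 * L * θ / s) ^
          ((1 / 2) * (s / 2) ^ stableExponent q * stableRank T q) := by
  have hθ := hX.theta_pos
  have hL := hX.const_pos
  have hp := one_le_stableExponent hq
  have hm0 : (0 : ℝ) < m := by exact_mod_cast hm
  obtain ⟨e, he⟩ := exists_orthonormalBasis_sum_norm_starProjection_adjoint_sq u T
  -- `‖T‖_{S_2}² = m`
  have hS2 : schattenNorm T 2 ^ 2 = m := by
    rw [schattenNorm_two_sq]
    have := he ⊤
    simp only [Submodule.starProjection_top, ContinuousLinearMap.id_apply, hT,
      e.norm_eq_one] at this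
    simpa using this.symm
  set k := stableRank T q with hk
  set p := stableExponent q
  set N := schattenNorm T q
  have hN0 : N ≠ 0 := by
    intro h0
    have := sum_sq_singularValues_mul_le T hq (fun _ => 1) (by simp) (by simp)
    simp only [mul_one, ← schattenNorm_two_sq, hS2] at this
    change _ ≤ N ^ 2 * _ at this
    rw [h0] at this
    simp at this
    linarith
  have hN : 0 < N := lt_of_le_of_ne (schattenNorm_nonneg T q) hN0.symm
  have hkeq : k = (m / N ^ 2) ^ p := by rw [hk, stableRank_eq_rpow, hS2]
  have hk0 : 0 < k := by rw [hkeq]; positivity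
  have hrank := stableRank_le_finrank_range T hq
  rw [← hk] at hrank
  have hkn : k ≤ n := hrank.trans (by
    have := LinearMap.finrank_range_le T
    rw [finrank_euclideanSpace_fin] at this
    exact_mod_cast this)
  have hkm : k ≤ m := hrank.trans (by
    have := Submodule.finrank_le T.range
    rw [finrank_euclideanSpace_fin] at this
    exact_mod_cast this)
  have hs2 : (s / 2) ^ p ≤ 1 / 2 := by
    calc (s / 2) ^ p ≤ (s / 2) ^ (1 : ℝ) :=
          Real.rpow_le_rpow_of_exponent_ge (by linarith) (by linarith) hp
      _ ≤ _ := by rw [Real.rpow_one]; linarith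
  have hs20 : 0 < (s / 2) ^ p := by positivity
  set D := (1 / 2) * (s / 2) ^ p * k with hD
  have hD0 : 0 < D := by positivity
  have hDk : D ≤ k / 4 := by
    rw [hD]
    nlinarith
  -- the length of the tuples: every natural number below `d` is less than `D`
  set d := ⌈D⌉₊ with hd
  have hd1 : 1 ≤ d := Nat.one_le_iff_ne_zero.2 (Nat.ceil_pos.2 hD0).ne'
  have hdn : d + 1 ≤ n := by
    have h1 : (d : ℝ) < D + 1 := Nat.ceil_lt_add_one hD0.le
    have h2 : (d : ℝ) < n := by
      have : (2 : ℝ) ≤ n := by exact_mod_cast hn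
      linarith
    exact_mod_cast h2
  -- the prefactor is `m / D ≥ 1`
  have hpre : 1 ≤ 2 * (2 / s) ^ p * (m / k) := by
    have h1 : 1 ≤ (2 / s) ^ p :=
      Real.one_le_rpow (by rw [le_div_iff₀ hs]; linarith) (by linarith)
    have h2 : 1 ≤ m / k := by rwa [le_div_iff₀ hk0, one_mul]
    nlinarith
  set B := 2 * Real.exp 4 * L * θ / s with hB
  have hB0 : 0 < B := by positivity
  have hmain : ν.real {x | s * m ≤
        ({i : Fin m | |inner ℝ (LinearMap.adjoint T (u i)) x| ≤ θ} : Set (Fin m)).ncard}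
      ≤ B ^ d := by
    have key := measure_card_small_mul_pow_le ν hθ (fun i => LinearMap.adjoint T (u i)) hT
      (d := d) (ENNReal.ofReal ((L * θ) ^ d))
      (fun F hF z => by
        rw [ENNReal.le_ofReal_iff_toReal_le (measure_ne_top _ _) (by positivity)]
        exact hX.small_ball d hd1 hdn F hF z)
      (a := s * m) (β := s * m / 2) (by nlinarith)
      (fun F hF => by
        have h1 : ((Module.finrank ℝ F : ℕ) : ℝ) < D := Nat.lt_ceil.1 hF
        have h2 : ∑ r, ‖F.starProjection (e r)‖ ^ 2 = Module.finrank ℝ F :=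
          sum_norm_starProjection_sq e F
        -- `‖T‖_{S_q}² (dim F) ^ (1 / p) ≤ s m / 2`, since `dim F < D ≤ (s / 2) ^ p * k`
        rw [he]
        refine (sum_sq_singularValues_mul_le T hq _ (fun r => by positivity) (fun r =>
          pow_le_one₀ (norm_nonneg _) ((F.norm_starProjection_apply_le _).trans_eq
            (e.norm_eq_one r)))).trans ?_
        rw [h2]
        have h4 : ((Module.finrank ℝ F : ℕ) : ℝ) ^ (1 / p) ≤ s / 2 * (m / N ^ 2) := by
          calc ((Module.finrank ℝ F : ℕ) : ℝ) ^ (1 / p)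
              ≤ ((s / 2 * (m / N ^ 2)) ^ p) ^ (1 / p) := by
                refine Real.rpow_le_rpow (by positivity) ?_ (by positivity)
                rw [Real.mul_rpow (by positivity) (by positivity), ← hkeq]
                nlinarith
            _ = _ := by
                rw [one_div, Real.rpow_rpow_inv (by positivity) (by linarith)]
        calc N ^ 2 * ((Module.finrank ℝ F : ℕ) : ℝ) ^ (1 / p)
            ≤ N ^ 2 * (s / 2 * (m / N ^ 2)) := by gcongr
          _ = s * m / 2 := by field_simp)
    have hreal := ENNReal.toReal_mono (by finiteness) key
    rw [ENNReal.toReal_mul, ENNReal.toReal_mul, ENNReal.toReal_mul, ENNReal.toReal_pow,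
      ENNReal.toReal_pow, ENNReal.toReal_ofReal (pow_nonneg (by nlinarith) d),
      ENNReal.toReal_ofReal (by positivity), ENNReal.toReal_ofReal (by positivity),
      Fintype.card_fin, ENNReal.toReal_natCast] at hreal
    have e1 : s * m - s * m / 2 = s * m / 2 := by ring
    have e2 : (m : ℝ) ^ d * (Real.exp 4 ^ d * (L * θ) ^ d) = (s * m / 2) ^ d * B ^ d := by
      rw [← mul_pow, ← mul_pow, ← mul_pow, hB]
      congr 1
      field_simp
    rw [e1, e2] at hreal
    exact le_of_mul_le_mul_left hreal (by positivity)
  have hone : ν.real {x | s * m ≤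
      ({i : Fin m | |inner ℝ (LinearMap.adjoint T (u i)) x| ≤ θ} : Set (Fin m)).ncard} ≤ 1 :=
    measureReal_le_one
  have hfin : ν.real {x | s * m ≤
      ({i : Fin m | |inner ℝ (LinearMap.adjoint T (u i)) x| ≤ θ} : Set (Fin m)).ncard}
        ≤ B ^ D := by
    rcases le_total 1 B with h | h
    · exact hone.trans (Real.one_le_rpow h hD0.le)
    · refine hmain.trans ?_
      rw [← Real.rpow_natCast]
      exact Real.rpow_le_rpow_of_exponent_ge hB0 h (Nat.le_ceil D)
  exact hfin.trans (le_mul_of_one_le_left (by positivity) hpre)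

lemma WeakSmallBall.map {Ω : Type*} [MeasurableSpace Ω] {μ : Measure Ω} {n : ℕ}
    {X : Ω → EuclideanSpace ℝ (Fin n)} {θ L : ℝ} (h : WeakSmallBall μ X θ L)
    (hX : AEMeasurable X μ) : WeakSmallBall (μ.map X) id θ L where
  theta_pos := h.theta_pos
  const_pos := h.const_pos
  mul_lt_one := h.mul_lt_one
  small_ball k hk hkn F hF z := by
    have hmeas : MeasurableSet {x | ‖F.starProjection (id x) - z‖ ≤ θ * √(k : ℝ)} :=
      measurableSet_le (by fun_prop) measurable_const
    rw [Measure.real, Measure.map_apply_of_aemeasurable hX hmeas]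
    exact h.small_ball k hk hkn F hF z

theorem theorem1p9 :
    ∃ (c : ℝ) (cq : ℝ≥0∞ → ℝ), 0 < c ∧
      (∀ q : ℝ≥0∞, 2 < q → 0 < cq q ∧ cq q ≤ c * √(stableExponent q)) ∧
      ∀ (Ω : Type*) [MeasurableSpace Ω] (μ : Measure Ω) [IsProbabilityMeasure μ]
        (n m : ℕ), 2 ≤ n → 1 ≤ m →
      ∀ (X : Ω → EuclideanSpace ℝ (Fin n)), AEMeasurable X μ →
      ∀ (θ L : ℝ), WeakSmallBall μ X θ L →
      ∀ (u : OrthonormalBasis (Fin m) ℝ (EuclideanSpace ℝ (Fin m)))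
        (T : EuclideanSpace ℝ (Fin n) →ₗ[ℝ] EuclideanSpace ℝ (Fin m)),
        (∀ i, ‖LinearMap.adjoint T (u i)‖ = 1) →
      ∀ q : ℝ≥0∞, 2 < q → ∀ s : ℝ, 0 < s → s < 1 →
        μ.real {ω | (({i : Fin m | θ ≤ |inner ℝ (T (X ω)) (u i)|} : Set (Fin m)).ncard : ℝ)
            ≤ (1 - s) * m}
          ≤ 2 * (2 / s) ^ stableExponent q * (m / stableRank T q) *
            (cq q * L * θ / s) ^ ((1 / 2) * (s / 2) ^ stableExponent q * stableRank T q) := by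
  refine ⟨2 * Real.exp 4, fun _ => 2 * Real.exp 4, by positivity, fun q hq => ⟨by positivity, ?_⟩,
    ?_⟩
  · exact le_mul_of_one_le_right (by positivity)
      (Real.one_le_sqrt.2 (one_le_stableExponent hq))
  intro Ω _ μ _ n m hn hm X hX θ L hW u T hT q hq s hs hs1
  have : IsProbabilityMeasure (μ.map X) := Measure.isProbabilityMeasure_map hX
  refine le_trans ?_ (measure_card_small_le hn hm (μ.map X) (hW.map hX) u T hT hq hs hs1)
  refine ENNReal.toReal_mono (measure_ne_top _ _) (le_trans (measure_mono ?_)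
    (Measure.le_map_apply hX _))
  intro ω hω
  simp only [Set.mem_ofPred_eq, Set.mem_preimage] at hω ⊢
  have hcompl : ({i : Fin m | θ ≤ |inner ℝ (T (X ω)) (u i)|} : Set (Fin m))ᶜ
      ⊆ {i : Fin m | |inner ℝ (LinearMap.adjoint T (u i)) (X ω)| ≤ θ} := by
    intro i hi
    simp only [Set.mem_compl_iff, Set.mem_ofPred_eq, not_le] at hi ⊢
    rw [LinearMap.adjoint_inner_left, real_inner_comm]
    exact hi.le
  have h1 := Set.ncard_le_ncard hcompl
  have h2 := Set.ncard_add_ncard_compl ({i : Fin m | θ ≤ |inner ℝ (T (X ω)) (u i)|} : Set (Fin m))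
  rw [Nat.card_eq_fintype_card, Fintype.card_fin] at h2
  have h1' : (({i : Fin m | θ ≤ |inner ℝ (T (X ω)) (u i)|} : Set (Fin m))ᶜ.ncard : ℝ)
      ≤ ({i : Fin m | |inner ℝ (LinearMap.adjoint T (u i)) (X ω)| ≤ θ} : Set (Fin m)).ncard := by
    exact_mod_cast h1
  have h2' : (({i : Fin m | θ ≤ |inner ℝ (T (X ω)) (u i)|} : Set (Fin m)).ncard : ℝ)
      + (({i : Fin m | θ ≤ |inner ℝ (T (X ω)) (u i)|} : Set (Fin m))ᶜ.ncard : ℝ) = m := by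
    exact_mod_cast h2
  linarith
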